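/- Let $N\ge 1$ items $i\in\{1,\dots,N\}$ be given, item $i$ having a weight $\omega(i)>0$ and a value $\nu(i)\in\mathbb{R}$, with $\sum_{i=1}^N\omega(i)=1$. Let $0\le n\le N$ and let $(I_1,\dots,I_n)$ be a sample drawn without replacement with probability proportional to the weights, i.e. for every $n$-tuple $(i_1,\dots,i_n)$ of distinct indices in $\{1,\dots,N\}$, $$\mathbb{P}\big((I_1,\dots,I_n)=(i_1,\dots,i_n)\big)=\prod_{k=1}^n\frac{\omega(i_k)}{1-\omega(i_1)-\cdots-\omega(i_{k-1})}.$$ Let $X=\nu(I_1)+\cdots+\nu(I_n)$ and put $$\Delta=\max_{i}\nu(i)-\min_{i}\nu(i),\qquad \alpha=\frac{\min_{i}\omega(i)}{\max_{i}\omega(i)}.$$ Assume $\alpha<1$. Then for all $t>0$, $$\max\big\{\mathbb{P}(X-\mathbb{E}X>t),\ \mathbb{P}(X-\mathbb{E}X<-t)\big\}\le\exp\left(-\frac{t^2}{2v}\right),$$ where $$v=\min\left(4\Delta^2 n,\ \frac{1+4\alpha}{\alpha(1-\alpha)}\,\Delta^2 N\left(\frac{N-n}{N}\right)^{\alpha}\right),$$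 and where the right-hand side is read as $0$ if $v=0$ (that is, if $\Delta=0$, $n=0$ or $n=N$). -/

import Mathlib

open MeasureTheory

/-- Probability that successive draws without replacement, each proportional to the weights of the
items still present, produce the tuple `i` of distinct items: the product over `k` of
`w (i k) / (1 - w (i 1) - ⋯ - w (i (k-1)))`. -/
noncomputable def successiveProb {N n : ℕ} (w : Fin N → ℝ) (i : Fin n → Fin N) : ℝ :=
  ∏ k, w (i k) / (1 - ∑ j ∈ Finset.Iio k, w (i j))

/-- `I = (I 1, …, I n)` is, under `P`, a sample of length `n` drawn without replacement from the
items `Fin N` with probability proportional to the weights `w`. (For positive weights of total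
mass `1` and `n ≤ N`, the prescribed probabilities add up to `1`, so they determine the law.) -/
structure IsWeightedSample {N n : ℕ} {Ω : Type*} [MeasurableSpace Ω] (P : Measure Ω)
    (w : Fin N → ℝ) (I : Fin n → Ω → Fin N) : Prop where
  measurable : ∀ k, Measurable (I k)
  law : ∀ i : Fin n → Fin N, Function.Injective i →
    P.real {x | ∀ k, I k x = i k} = successiveProb w i

/-- The cumulative value `X = ν (I 1) + ⋯ + ν (I n)` of the sample. -/
def cumulativeValue {N n : ℕ} {Ω : Type*} (ν : Fin N → ℝ) (I : Fin n → Ω → Fin N) (x : Ω) : ℝ :=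
  ∑ k, ν (I k x)

/-- `Δ = max ν - min ν`. -/
noncomputable def valueRange {N : ℕ} (ν : Fin N → ℝ) : ℝ := (⨆ i, ν i) - ⨅ i, ν i

/-- `α = min w / max w`. -/
noncomputable def weightRatio {N : ℕ} (w : Fin N → ℝ) : ℝ := (⨅ i, w i) / ⨆ i, w i

/-- The variance factor
`v = min (4 Δ² n, (1 + 4 α) / (α (1 - α)) Δ² N ((N - n) / N) ^ α)`. -/
noncomputable def varianceFactor {N : ℕ} (n : ℕ) (w ν : Fin N → ℝ) : ℝ :=
  min (4 * valueRange ν ^ 2 * (n : ℝ))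
    ((1 + 4 * weightRatio w) / (weightRatio w * (1 - weightRatio w)) * valueRange ν ^ 2 * (N : ℝ) *
      (((N : ℝ) - (n : ℝ)) / (N : ℝ)) ^ weightRatio w)

/-!
Write `X` for the cumulative value and `d = N - n` for the number of items never drawn. The proof
bounds the moment generating function of `X - 𝔼 X` one draw at a time, as in the Azuma–Hoeffding
inequality, and computes with the recursion `drawExp`, which conditions on the first draw.

The point is how much the first draw can change the conditional mean of `X`. If it is `a` rather
than `b`, the remaining items are `T ∪ {b}` rather than `T ∪ {a}`. Drawing from both sets at
once (`swap_step`), one can let the two samples agree for good with the probability that the lighter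
of the two exchanged items is drawn from its set, and differ again by the exchange of one item
otherwise. When `p` items remain besides the exchanged one, they differ still with probability at
most `1 / (1 + α / p) ≤ (p / (p + 1)) ^ α`, by Bernoulli's inequality. These factors telescope: with
`m` draws to come after the first, the conditional mean changes by at most `Δ (d / (m + d)) ^ α`
(`abs_swap_le`).

Hoeffding's lemma then shows that `X - 𝔼 X` is sub-Gaussian with variance proxy
`∑ j < n, (Δ (d / (j + d)) ^ α / 2) ^ 2` (`drawExp_exp_le`). A comparison of `∑ s ^ (-α)` with
`N ^ (1 - α) / (1 - α)` bounds it by the variance factor (`varianceProxy_le_left`,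
`varianceProxy_le_right`), and Chernoff's bound concludes. For `n = N` all summands vanish, as
`0 ^ α = 0` for the `α > 0` at hand (and `0 / 0 = 0` for the last draw, which has only one item to
choose from), so that the degenerate cases need no separate argument: a variable which is
sub-Gaussian with proxy `0` vanishes almost surely.
-/

/-! ### Successive draws from a finite set -/

/-- The expectation of `f (i 0, …, i (m - 1))`, where `i 0, …, i (m - 1)` are successive draws
without replacement from `S`, each made with probability proportional to the weights `w` of the
items still present. It is defined by conditioning on the first draw. -/
noncomputable def drawExp {ι : Type*} [DecidableEq ι] (w : ι → ℝ) :
    (m : ℕ) → Finset ι → ((Fin m → ι) → ℝ) → ℝ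
  | 0, _, f => f Fin.elim0
  | m + 1, S, f =>
    ∑ a ∈ S, w a / (∑ b ∈ S, w b) * drawExp w m (S.erase a) fun i => f (Fin.cons a i)

/-- The expected total value of `m` successive draws from `S`. -/
noncomputable def drawMean {ι : Type*} [DecidableEq ι] (w ν : ι → ℝ) (m : ℕ) (S : Finset ι) : ℝ :=
  drawExp w m S fun i => ∑ k, ν (i k)

lemma sum_div_sum_eq_one {ι : Type*} {w : ι → ℝ} (hw : ∀ i, 0 < w i) {S : Finset ι}
    (hS : S.Nonempty) :
    ∑ a ∈ S, w a / (∑ b ∈ S, w b) = 1 := by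
  rw [← Finset.sum_div]
  exact div_self (Finset.sum_pos (fun i _ => hw i) hS).ne'

section DrawExp

variable {ι : Type*} [DecidableEq ι] {w : ι → ℝ}

lemma drawExp_const_mul (c : ℝ) (m : ℕ) (S : Finset ι) (f : (Fin m → ι) → ℝ) :
    drawExp w m S (fun i => c * f i) = c * drawExp w m S f := by
  induction m generalizing S with
  | zero => rfl
  | succ m ih =>
    simp only [drawExp]
    rw [Finset.mul_sum]
    refine Finset.sum_congr rfl fun a _ => ?_
    rw [ih]
    ring

lemma drawExp_add (m : ℕ) (S : Finset ι) (f g : (Fin m → ι) → ℝ) :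
    drawExp w m S (fun i => f i + g i) = drawExp w m S f + drawExp w m S g := by
  induction m generalizing S with
  | zero => rfl
  | succ m ih =>
    simp only [drawExp]
    rw [← Finset.sum_add_distrib]
    refine Finset.sum_congr rfl fun a _ => ?_
    rw [ih]
    ring

lemma drawExp_const (hw : ∀ i, 0 < w i) (c : ℝ) {m : ℕ} {S : Finset ι} (hm : m ≤ S.card) :
    drawExp w m S (fun _ => c) = c := by
  induction m generalizing S with
  | zero => rfl
  | succ m ih =>
    simp only [drawExp]
    have h : ∀ a ∈ S, w a / (∑ b ∈ S, w b) * drawExp w m (S.erase a) (fun _ => c)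
        = w a / (∑ b ∈ S, w b) * c := fun a ha => by
      rw [ih (by rw [Finset.card_erase_of_mem ha]; omega)]
    rw [Finset.sum_congr rfl h, ← Finset.sum_mul,
      sum_div_sum_eq_one hw (Finset.card_pos.1 (by omega)), one_mul]

lemma drawMean_zero (ν : ι → ℝ) (S : Finset ι) : drawMean w ν 0 S = 0 := by
  simp [drawMean, drawExp]

lemma drawMean_succ (hw : ∀ i, 0 < w i) (ν : ι → ℝ) {m : ℕ} {S : Finset ι}
    (hm : m + 1 ≤ S.card) :
    drawMean w ν (m + 1) S
      = ∑ a ∈ S, w a / (∑ b ∈ S, w b) * (ν a + drawMean w ν m (S.erase a)) := by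
  simp only [drawMean, drawExp, Fin.sum_univ_succ, Fin.cons_zero, Fin.cons_succ]
  refine Finset.sum_congr rfl fun a ha => ?_
  rw [drawExp_add, drawExp_const hw _ (by rw [Finset.card_erase_of_mem ha]; omega)]

/-- Unfolding the recursion: the tuple `i` of distinct items of `S` has probability
`∏ k, w (i k) / (∑ b ∈ S, w b - ∑ j < k, w (i j))`. -/
lemma drawExp_eq_sum [Fintype ι] (m : ℕ) (S : Finset ι) (f : (Fin m → ι) → ℝ) :
    drawExp w m S f = ∑ i : Fin m → ι, if Function.Injective i ∧ ∀ k, i k ∈ S then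
      (∏ k, w (i k) / (∑ b ∈ S, w b - ∑ j ∈ Finset.Iio k, w (i j))) * f i else 0 := by
  induction m generalizing S with
  | zero =>
    rw [Fintype.sum_unique, if_pos ⟨fun a => a.elim0, fun a => a.elim0⟩]
    simp only [drawExp, Finset.univ_eq_empty, Finset.prod_empty, one_mul]
    exact congrArg f (Subsingleton.elim _ _)
  | succ m ih =>
    rw [← (Fin.consEquiv fun _ => ι).sum_comp, Fintype.sum_prod_type]
    simp only [drawExp, ih]
    rw [← Finset.sum_subset (Finset.subset_univ S)]
    · refine Finset.sum_congr rfl fun a ha => ?_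
      rw [Finset.mul_sum]
      refine Finset.sum_congr rfl fun i _ => ?_
      have hiff : (Function.Injective (Fin.cons a i : Fin (m + 1) → ι) ∧
            ∀ k, (Fin.cons a i : Fin (m + 1) → ι) k ∈ S)
          ↔ Function.Injective i ∧ ∀ k, i k ∈ S.erase a := by
        simp only [Fin.cons_injective_iff, Fin.forall_fin_succ, Fin.cons_zero, Fin.cons_succ,
          Finset.mem_erase, Set.mem_range, not_exists, forall_and, ha, true_and]
        tauto
      have hcons : (Fin.consEquiv fun _ => ι) (a, i) = Fin.cons a i := rfl
      rw [hcons, if_congr hiff rfl rfl]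
      split_ifs with h
      · rw [Fin.prod_univ_succ, ← mul_assoc]
        congr 1
        have h0 : Finset.Iio (0 : Fin (m + 1)) = ∅ := by
          ext j; simp
        simp only [Fin.cons_zero, Fin.cons_succ, h0, Finset.sum_empty, sub_zero]
        congr 1
        refine Finset.prod_congr rfl fun k _ => ?_
        have hs : Finset.Iio k.succ = Finset.cons 0 ((Finset.Iio k).map (Fin.succEmb m))
            (by simp) := by
          ext j
          refine Fin.cases ?_ (fun j => ?_) j <;> simp
        rw [hs, Finset.sum_cons, Finset.sum_map, ← Finset.add_sum_erase S w ha]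
        simp only [Fin.cons_zero, Fin.coe_succEmb, Fin.cons_succ]
        congr 1
        ring
      · simp
    · intro a _ ha
      refine Finset.sum_eq_zero fun i _ => if_neg fun h => ha ?_
      simpa using h.2 0

end DrawExp

/-! ### The effect of exchanging one item -/

/-- The left-hand side is the probability that a draw from `T ∪ {b}` is not `b`. -/
lemma sum_div_le_rpow {ι : Type*} {w : ι → ℝ} (hw : ∀ i, 0 < w i) {α : ℝ} (hα0 : 0 ≤ α)
    (hα1 : α ≤ 1) (hα : ∀ i j, α * w i ≤ w j) (T : Finset ι) (hT : T.Nonempty) (b : ι) :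
    (∑ c ∈ T, w c) / (∑ c ∈ T, w c + w b) ≤ ((T.card : ℝ) / (T.card + 1)) ^ α := by
  have hp : (0 : ℝ) < T.card := by exact_mod_cast hT.card_pos
  have hW : 0 < ∑ c ∈ T, w c := Finset.sum_pos (fun i _ => hw i) hT
  have h1 : α * ∑ c ∈ T, w c ≤ T.card * w b := by
    rw [Finset.mul_sum, ← nsmul_eq_mul]
    exact Finset.sum_le_card_nsmul _ _ _ fun i _ => hα i b
  have h2 : (1 + 1 / (T.card : ℝ)) ^ α ≤ 1 + α * (1 / (T.card : ℝ)) :=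
    rpow_one_add_le_one_add_mul_self (by have := one_div_pos.2 hp; linarith) hα0 hα1
  have h3 : 1 + α * (1 / (T.card : ℝ)) ≤ (∑ c ∈ T, w c + w b) / ∑ c ∈ T, w c := by
    rw [add_div, div_self hW.ne', mul_one_div]
    gcongr 1 + ?_
    rw [div_le_div_iff₀ hp hW]
    linarith
  have h4 : (T.card : ℝ) / (T.card + 1) = (1 + 1 / (T.card : ℝ))⁻¹ := by
    field_simp
  rw [h4, Real.inv_rpow (by positivity), ← inv_div]
  exact inv_anti₀ (by positivity) (h2.trans h3)

section Swap

variable {ι : Type*} [DecidableEq ι] {w : ι → ℝ}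

/-- One step of the coupling, written as an identity of expectations: for `w b ≤ w a`, draw from
`T ∪ {b}` and from `T ∪ {a}` at the same time. With probability `w b / (w b + w T)` the former draw
is `b` and the latter is `a`, after which the two samples agree. Otherwise the former draw is some
`c ∈ T`, the latter is `c` or `a`, and the two samples again differ by the exchange of one item. -/
lemma swap_step (hw : ∀ i, 0 < w i) (ν : ι → ℝ) {m : ℕ} {T : Finset ι} {a b : ι}
    (ha : a ∉ T) (hb : b ∉ T) (hm : m ≤ T.card) :
    ν a + drawMean w ν (m + 1) (insert b T) - (ν b + drawMean w ν (m + 1) (insert a T))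
      = ∑ c ∈ T, (w c / (∑ c ∈ T, w c + w a) *
          (ν a + drawMean w ν m (insert b (T.erase c))
            - (ν b + drawMean w ν m (insert a (T.erase c)))) +
        w c * (1 / (∑ c ∈ T, w c + w b) - 1 / (∑ c ∈ T, w c + w a)) *
          (ν c + drawMean w ν m (insert b (T.erase c)) - (ν b + drawMean w ν m T))) := by
  have hW : 0 ≤ ∑ c ∈ T, w c := Finset.sum_nonneg fun i _ => (hw i).le
  have hWa : ∑ c ∈ T, w c + w a ≠ 0 := by have := hw a; positivity
  have hWb : ∑ c ∈ T, w c + w b ≠ 0 := by have := hw b; positivity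
  have hrec : ∀ e ∉ T, drawMean w ν (m + 1) (insert e T)
      = w e / (∑ c ∈ T, w c + w e) * (ν e + drawMean w ν m T) +
        ∑ c ∈ T, w c / (∑ c ∈ T, w c + w e) *
          (ν c + drawMean w ν m (insert e (T.erase c))) := by
    intro e he
    rw [drawMean_succ hw ν (by rw [Finset.card_insert_of_notMem he]; omega),
      Finset.sum_insert he, Finset.sum_insert he, Finset.erase_insert he, add_comm (w e)]
    congr 1
    refine Finset.sum_congr rfl fun c hc => ?_
    rw [Finset.erase_insert_of_ne (by rintro rfl; exact he hc)]
  rw [hrec a ha, hrec b hb]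
  set W := ∑ c ∈ T, w c with hWdef
  -- The terms independent of `c`, among them the multiples of `drawMean w ν m T`, agree because the
  -- weights `w c` add up to `W`.
  have key : ∀ x : ℝ, ∑ c ∈ T, w c * x = W * x := fun x => by rw [← Finset.sum_mul]
  have hsplit : ∀ c, w c / (W + w a) *
          (ν a + drawMean w ν m (insert b (T.erase c))
            - (ν b + drawMean w ν m (insert a (T.erase c)))) +
        w c * (1 / (W + w b) - 1 / (W + w a)) *
          (ν c + drawMean w ν m (insert b (T.erase c)) - (ν b + drawMean w ν m T))
      = w c / (W + w b) * (ν c + drawMean w ν m (insert b (T.erase c)))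
        - w c / (W + w a) * (ν c + drawMean w ν m (insert a (T.erase c)))
        + w c * (1 / (W + w a) * (ν a - ν b)
          - (1 / (W + w b) - 1 / (W + w a)) * (ν b + drawMean w ν m T)) := by
    intro c
    ring
  rw [Finset.sum_congr rfl fun c _ => hsplit c, Finset.sum_add_distrib, Finset.sum_sub_distrib,
    key]
  field_simp
  ring

/-- Replacing one drawn item by another changes the expected total of the drawn item and of `m`
further draws by at most `Δ (d / (m + d)) ^ α`, where `d` items are left at the end. -/
lemma abs_swap_le (hw : ∀ i, 0 < w i) {ν : ι → ℝ} {α Δ : ℝ} (hα0 : 0 < α) (hα1 : α ≤ 1)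
    (hα : ∀ i j, α * w i ≤ w j) (hΔ : ∀ i j, |ν i - ν j| ≤ Δ) (d m : ℕ) (T : Finset ι) (a b : ι)
    (ha : a ∉ T) (hb : b ∉ T) (hT : T.card + 1 = m + d) :
    |ν a + drawMean w ν m (insert b T) - (ν b + drawMean w ν m (insert a T))|
      ≤ Δ * ((d : ℝ) / (m + d)) ^ α := by
  have hΔ0 : 0 ≤ Δ := (abs_nonneg _).trans (hΔ a a)
  induction m generalizing T a b with
  | zero =>
    have hd : (d : ℝ) ≠ 0 := by
      have : d ≠ 0 := by omega
      exact_mod_cast this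
    simpa [drawMean_zero, div_self hd] using hΔ a b
  | succ m ih =>
    wlog hab : w b ≤ w a generalizing a b
    · rw [abs_sub_comm]
      exact this b a hb ha (le_of_not_ge hab)
    rw [swap_step hw ν ha hb (by omega)]
    set W := ∑ c ∈ T, w c with hWdef
    set D := Δ * ((d : ℝ) / (m + d)) ^ α with hD
    rcases T.eq_empty_or_nonempty with rfl | hne
    · simp only [Finset.sum_empty, abs_zero]
      positivity
    have hW : 0 < W := Finset.sum_pos (fun i _ => hw i) hne
    have hterm : ∀ c ∈ T, |w c / (W + w a) *
          (ν a + drawMean w ν m (insert b (T.erase c))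
            - (ν b + drawMean w ν m (insert a (T.erase c)))) +
        w c * (1 / (W + w b) - 1 / (W + w a)) *
          (ν c + drawMean w ν m (insert b (T.erase c)) - (ν b + drawMean w ν m T))|
        ≤ w c * (1 / (W + w b) * D) := by
      intro c hc
      have hcard : (T.erase c).card + 1 = m + d := by
        rw [Finset.card_erase_add_one hc]
        omega
      have h1 := ih (T.erase c) a b (fun h => ha (Finset.mem_of_mem_erase h))
        (fun h => hb (Finset.mem_of_mem_erase h)) hcard
      have h2 := ih (T.erase c) c b (Finset.notMem_erase c T)
        (fun h => hb (Finset.mem_of_mem_erase h)) hcard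
      rw [Finset.insert_erase hc] at h2
      have hinv : 0 ≤ 1 / (W + w b) - 1 / (W + w a) :=
        sub_nonneg.2 (one_div_le_one_div_of_le (by have := hw b; positivity) (by linarith))
      have hc0 := hw c
      have ha0 := hw a
      refine (abs_add_le _ _).trans ?_
      rw [abs_mul, abs_mul, abs_of_nonneg (by positivity : 0 ≤ w c / (W + w a)),
        abs_of_nonneg (mul_nonneg hc0.le hinv)]
      calc _ ≤ w c / (W + w a) * D + w c * (1 / (W + w b) - 1 / (W + w a)) * D := by
            gcongr
        _ = w c * (1 / (W + w b) * D) := by ring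
    calc _ ≤ ∑ c ∈ T, w c * (1 / (W + w b) * D) :=
          (Finset.abs_sum_le_sum_abs _ _).trans (Finset.sum_le_sum hterm)
      _ = W / (W + w b) * D := by
          rw [← Finset.sum_mul]
          ring
      _ ≤ ((T.card : ℝ) / (T.card + 1)) ^ α * D := by
          gcongr
          exact sum_div_le_rpow hw hα0.le hα1 hα T hne b
      _ = Δ * ((d : ℝ) / ((m + 1 : ℕ) + d)) ^ α := by
          have hcard : (T.card : ℝ) = m + d := by
            have : T.card = m + d := by omega
            exact_mod_cast this
          have hpos : (0 : ℝ) < m + d := by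
            rw [← hcard]
            exact_mod_cast hne.card_pos
          rw [hD, mul_left_comm, hcard, ← Real.mul_rpow (by positivity) (by positivity)]
          congr 2
          push_cast
          field_simp
          ring

end Swap

/-! ### The moment generating function -/

/-- Hoeffding's lemma for a probability vector `p` on a finite set. -/
lemma sum_mul_exp_le {ι : Type*} {S : Finset ι} (hS : S.Nonempty) {p x : ι → ℝ} {c : ℝ}
    (hp : ∀ a ∈ S, 0 ≤ p a) (hp1 : ∑ a ∈ S, p a = 1)
    (hx : ∀ a ∈ S, ∀ b ∈ S, |x a - x b| ≤ c) (s : ℝ) :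
    ∑ a ∈ S, p a * Real.exp (s * x a)
      ≤ Real.exp (s * ∑ a ∈ S, p a * x a + s ^ 2 / 2 * (c / 2) ^ 2) := by
  let _ : MeasurableSpace ι := ⊤
  set μ : Measure ι := ∑ a ∈ S, ENNReal.ofReal (p a) • Measure.dirac a with hμ
  have hint : ∀ f : ι → ℝ, ∫ a, f a ∂μ = ∑ a ∈ S, p a * f a := by
    intro f
    rw [hμ, integral_finsetSum_measure fun a _ =>
      (integrable_dirac (by simp)).smul_measure ENNReal.ofReal_ne_top]
    refine Finset.sum_congr rfl fun a ha => ?_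
    rw [integral_smul_measure, integral_dirac, ENNReal.toReal_ofReal (hp a ha), smul_eq_mul]
  have : IsProbabilityMeasure μ := by
    refine ⟨?_⟩
    simp only [hμ, Measure.finsetSum_apply, Measure.smul_apply, measure_univ, smul_eq_mul, mul_one]
    rw [← ENNReal.ofReal_sum_of_nonneg hp, hp1, ENNReal.ofReal_one]
  obtain ⟨a₀, ha₀, hmin⟩ := S.exists_min_image x hS
  have hae : ∀ᵐ a ∂μ, x a ∈ Set.Icc (x a₀) (x a₀ + c) := by
    have : ∀ᵐ a ∂μ, a ∈ S := by
      rw [ae_iff]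
      simp only [hμ, Measure.finsetSum_apply, Measure.smul_apply, smul_eq_mul]
      refine Finset.sum_eq_zero fun a ha => ?_
      simp [ha]
    filter_upwards [this] with a ha
    exact ⟨hmin a ha, by linarith [le_abs_self (x a - x a₀), hx a ha a₀ ha₀]⟩
  have h := (ProbabilityTheory.hasSubgaussianMGF_of_mem_Icc
    (measurable_from_top (f := x)).aemeasurable hae).mgf_le s
  simp only [ProbabilityTheory.mgf, hint, mul_sub, Real.exp_sub] at h
  simp only [mul_div_assoc'] at h
  rw [← Finset.sum_div, div_le_iff₀ (Real.exp_pos _), ← Real.exp_add] at h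
  refine h.trans_eq ?_
  congr 1
  push_cast
  rw [add_sub_cancel_left, Real.norm_eq_abs, div_pow, div_pow, sq_abs]
  ring

/-- A variance proxy for the total of `m` draws which leave `d` items. The `j`-th summand belongs to
the draw after which `j + d` items are left. -/
noncomputable def varianceProxy (Δ α : ℝ) (d m : ℕ) : ℝ :=
  ∑ j ∈ Finset.range m, (Δ * ((d : ℝ) / (j + d)) ^ α / 2) ^ 2

/-- Conditionally on the first draw, the remaining draws have the variance proxy of `m` draws; the
conditional mean varies with the first draw by at most the bound of `abs_swap_le`, and Hoeffding's
lemma applies to it. -/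
lemma drawExp_exp_le {ι : Type*} [DecidableEq ι] {w : ι → ℝ} (hw : ∀ i, 0 < w i) {ν : ι → ℝ}
    {α Δ : ℝ} (hα0 : 0 < α) (hα1 : α ≤ 1) (hα : ∀ i j, α * w i ≤ w j)
    (hΔ : ∀ i j, |ν i - ν j| ≤ Δ) (s : ℝ) (d m : ℕ) (S : Finset ι) (hS : S.card = m + d) :
    drawExp w m S (fun i => Real.exp (s * ∑ k, ν (i k)))
      ≤ Real.exp (s * drawMean w ν m S + s ^ 2 / 2 * varianceProxy Δ α d m) := by
  induction m generalizing S with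
  | zero => simp [drawExp, drawMean_zero, varianceProxy]
  | succ m ih =>
    have hne : S.Nonempty := Finset.card_pos.1 (by omega)
    have hp : ∀ a ∈ S, 0 ≤ w a / ∑ b ∈ S, w b := fun a _ =>
      div_nonneg (hw a).le (Finset.sum_nonneg fun i _ => (hw i).le)
    have hrange : ∀ a ∈ S, ∀ b ∈ S,
        |ν a + drawMean w ν m (S.erase a) - (ν b + drawMean w ν m (S.erase b))|
          ≤ Δ * ((d : ℝ) / (m + d)) ^ α := by
      intro a ha b hb
      rcases eq_or_ne a b with rfl | hab
      · -- For `m = d = 0` the bound is `Δ * (0 / 0) ^ α = 0`, which is right: `S` is a singleton.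
        have hΔ0 : 0 ≤ Δ := (abs_nonneg _).trans (hΔ a a)
        rw [sub_self, abs_zero]
        positivity
      have ha' : a ∈ S.erase b := Finset.mem_erase.2 ⟨hab, ha⟩
      have hb' : b ∈ S.erase a := Finset.mem_erase.2 ⟨hab.symm, hb⟩
      have h := abs_swap_le hw hα0 hα1 hα hΔ d m ((S.erase a).erase b) a b (by simp) (by simp)
        (by rw [Finset.card_erase_add_one hb', Finset.card_erase_of_mem ha]; omega)
      rwa [Finset.insert_erase hb', Finset.erase_right_comm, Finset.insert_erase ha'] at h
    have hstep : ∀ a ∈ S, w a / (∑ b ∈ S, w b) * drawExp w m (S.erase a)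
          (fun i => Real.exp (s * ∑ k, ν ((Fin.cons a i : Fin (m + 1) → ι) k)))
        ≤ w a / (∑ b ∈ S, w b) * Real.exp (s * (ν a + drawMean w ν m (S.erase a)))
          * Real.exp (s ^ 2 / 2 * varianceProxy Δ α d m) := by
      intro a ha
      rw [mul_assoc]
      refine mul_le_mul_of_nonneg_left ?_ (hp a ha)
      simp only [Fin.sum_univ_succ, Fin.cons_zero, Fin.cons_succ, mul_add, Real.exp_add,
        drawExp_const_mul]
      rw [mul_assoc, ← Real.exp_add]
      gcongr
      exact ih _ (by rw [Finset.card_erase_of_mem ha]; omega)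
    simp only [drawExp]
    refine (Finset.sum_le_sum hstep).trans ?_
    rw [← Finset.sum_mul, drawMean_succ hw ν (by omega)]
    refine (mul_le_mul_of_nonneg_right
      (sum_mul_exp_le hne hp (sum_div_sum_eq_one hw hne) hrange s) (Real.exp_pos _).le).trans_eq ?_
    rw [← Real.exp_add, varianceProxy, varianceProxy, Finset.sum_range_succ]
    congr 1
    ring

/-! ### Comparison with the variance factor -/

lemma sum_rpow_neg_le {α : ℝ} (hα0 : 0 ≤ α) (hα1 : α < 1) (M : ℕ) :
    ∑ j ∈ Finset.range M, ((j : ℝ) + 1) ^ (-α) ≤ (M : ℝ) ^ (1 - α) / (1 - α) := by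
  have hα : 0 < 1 - α := by linarith
  induction M with
  | zero => simp [Real.zero_rpow hα.ne']
  | succ M ih =>
    rw [Finset.sum_range_succ]
    have hM : (0 : ℝ) < M + 1 := by positivity
    -- Concavity of `x ↦ x ^ (1 - α)`, in the form of Bernoulli's inequality.
    have hB : (1 + -(1 / ((M : ℝ) + 1))) ^ (1 - α) ≤ 1 + (1 - α) * -(1 / ((M : ℝ) + 1)) := by
      refine rpow_one_add_le_one_add_mul_self ?_ hα.le (by linarith)
      rw [neg_le_neg_iff, div_le_one hM]
      linarith [(Nat.cast_nonneg M : (0 : ℝ) ≤ M)]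
    have hsplit : (M : ℝ) = (M + 1) * (1 + -(1 / ((M : ℝ) + 1))) := by
      field_simp
      ring
    have hle : (M : ℝ) ^ (1 - α) ≤ ((M : ℝ) + 1) ^ (1 - α) - (1 - α) * ((M : ℝ) + 1) ^ (-α) := by
      have h1 : ((M : ℝ) + 1) ^ (-α) = ((M : ℝ) + 1) ^ (1 - α) * (1 / ((M : ℝ) + 1)) := by
        rw [sub_eq_add_neg, Real.rpow_add hM, Real.rpow_one]
        field_simp
      have hnn : 0 ≤ 1 + -(1 / ((M : ℝ) + 1)) := by
        rw [← sub_eq_add_neg, sub_nonneg, div_le_one hM]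
        linarith [(Nat.cast_nonneg M : (0 : ℝ) ≤ M)]
      calc (M : ℝ) ^ (1 - α) = ((M + 1) * (1 + -(1 / ((M : ℝ) + 1)))) ^ (1 - α) := by
            rw [← hsplit]
        _ = ((M : ℝ) + 1) ^ (1 - α) * (1 + -(1 / ((M : ℝ) + 1))) ^ (1 - α) :=
            Real.mul_rpow hM.le hnn
        _ ≤ ((M : ℝ) + 1) ^ (1 - α) * (1 + (1 - α) * -(1 / ((M : ℝ) + 1))) := by gcongr
        _ = _ := by
            rw [h1]
            ring
    calc _ ≤ (M : ℝ) ^ (1 - α) / (1 - α) + ((M : ℝ) + 1) ^ (-α) := by gcongr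
      _ ≤ ((M + 1 : ℕ) : ℝ) ^ (1 - α) / (1 - α) := by
          push_cast
          rw [div_add' _ _ _ hα.ne']
          gcongr
          linarith

lemma varianceProxy_nonneg (Δ α : ℝ) (d m : ℕ) : 0 ≤ varianceProxy Δ α d m :=
  Finset.sum_nonneg fun _ _ => sq_nonneg _

lemma varianceProxy_le_left {Δ α : ℝ} (hα0 : 0 ≤ α) (d m : ℕ) :
    varianceProxy Δ α d m ≤ 4 * Δ ^ 2 * m := by
  have h : ∀ j ∈ Finset.range m, (Δ * ((d : ℝ) / (j + d)) ^ α / 2) ^ 2 ≤ 4 * Δ ^ 2 := by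
    intro j _
    have h0 : 0 ≤ ((d : ℝ) / (j + d)) ^ α := by positivity
    have h1 : ((d : ℝ) / (j + d)) ^ α ≤ 1 :=
      Real.rpow_le_one (by positivity)
        (div_le_one_of_le₀ (by linarith [(Nat.cast_nonneg j : (0 : ℝ) ≤ j)]) (by positivity)) hα0
    have h2 : (((d : ℝ) / (j + d)) ^ α) ^ 2 ≤ 1 := pow_le_one₀ h0 h1
    rw [div_pow, mul_pow]
    nlinarith [sq_nonneg Δ]
  refine (Finset.sum_le_card_nsmul _ _ _ h).trans_eq ?_
  rw [Finset.card_range, nsmul_eq_mul]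
  ring

lemma varianceProxy_le_right {Δ α : ℝ} (hα0 : 0 < α) (hα1 : α < 1) (d m : ℕ) :
    varianceProxy Δ α d m ≤ (1 + 4 * α) / (α * (1 - α)) * Δ ^ 2 * ((m + d : ℕ) : ℝ)
      * ((d : ℝ) / (m + d : ℕ)) ^ α := by
  have h1α : 0 < 1 - α := by linarith
  rcases Nat.eq_zero_or_pos d with rfl | hd
  · simp [varianceProxy, Real.zero_rpow hα0.ne']
  have hdR : (0 : ℝ) < d := by exact_mod_cast hd
  set N := m + d with hN
  have hNR : (0 : ℝ) < N := by
    rw [hN]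
    positivity
  have hterm : ∀ j ∈ Finset.range m, (Δ * ((d : ℝ) / (j + d)) ^ α / 2) ^ 2
      ≤ Δ ^ 2 * (d : ℝ) ^ α * (((d - 1 + j : ℕ) : ℝ) + 1) ^ (-α) := by
    intro j _
    have hj : (((d - 1 + j : ℕ) : ℝ) + 1) = j + d := by
      have : d - 1 + j + 1 = j + d := by omega
      exact_mod_cast this
    have h0 : 0 ≤ ((d : ℝ) / (j + d)) ^ α := by positivity
    have h1 : ((d : ℝ) / (j + d)) ^ α ≤ 1 :=
      Real.rpow_le_one (by positivity)
        (div_le_one_of_le₀ (by linarith [(Nat.cast_nonneg j : (0 : ℝ) ≤ j)]) (by positivity))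
        hα0.le
    rw [hj, mul_assoc, Real.rpow_neg (by positivity), ← div_eq_mul_inv,
      ← Real.div_rpow (by positivity) (by positivity), div_pow, mul_pow]
    have h2 : (((d : ℝ) / (j + d)) ^ α) ^ 2 ≤ ((d : ℝ) / (j + d)) ^ α := by
      rw [sq]
      exact mul_le_of_le_one_left h0 h1
    have h3 := mul_le_mul_of_nonneg_left h2 (sq_nonneg Δ)
    have h4 := mul_nonneg (sq_nonneg Δ) (sq_nonneg (((d : ℝ) / (j + d)) ^ α))
    linarith
  have hsum : ∑ j ∈ Finset.range m, (((d - 1 + j : ℕ) : ℝ) + 1) ^ (-α)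
      ≤ (N : ℝ) ^ (1 - α) / (1 - α) := by
    refine le_trans ?_ (sum_rpow_neg_le hα0.le hα1 N)
    have hle : d - 1 + m ≤ N := by omega
    refine le_trans ?_ (Finset.sum_le_sum_of_subset_of_nonneg (Finset.range_mono hle)
      fun j _ _ => by positivity)
    rw [Finset.sum_range_add]
    exact le_add_of_nonneg_left (Finset.sum_nonneg fun j _ => by positivity)
  have hfac : 1 / (1 - α) ≤ (1 + 4 * α) / (α * (1 - α)) := by
    rw [div_le_div_iff₀ h1α (by positivity)]
    nlinarith
  calc varianceProxy Δ α d m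
      ≤ ∑ j ∈ Finset.range m, Δ ^ 2 * (d : ℝ) ^ α * (((d - 1 + j : ℕ) : ℝ) + 1) ^ (-α) :=
        Finset.sum_le_sum hterm
    _ ≤ Δ ^ 2 * (d : ℝ) ^ α * ((N : ℝ) ^ (1 - α) / (1 - α)) := by
        rw [← Finset.mul_sum]
        gcongr
    _ = 1 / (1 - α) * (Δ ^ 2 * N * ((d : ℝ) / N) ^ α) := by
        rw [Real.div_rpow hdR.le hNR.le, Real.rpow_sub hNR, Real.rpow_one]
        ring
    _ ≤ (1 + 4 * α) / (α * (1 - α)) * (Δ ^ 2 * N * ((d : ℝ) / N) ^ α) := by gcongr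
    _ = _ := by ring

/-! ### The law of the sample -/

/-- The expectation of a function of the sample is given by the recursion `drawExp`. -/
lemma IsWeightedSample.integral_eq {N n : ℕ} (hn : n ≤ N) {w : Fin N → ℝ}
    (hw : ∀ i, 0 < w i) (hw1 : ∑ i, w i = 1) {Ω : Type*} [MeasurableSpace Ω] {P : Measure Ω}
    [IsProbabilityMeasure P] {I : Fin n → Ω → Fin N} (hI : IsWeightedSample P w I)
    (f : (Fin n → Fin N) → ℝ) :
    ∫ x, f (fun k => I k x) ∂P = drawExp w n Finset.univ f := by
  have hmeas : Measurable fun x k => I k x := measurable_pi_lambda _ hI.measurable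
  set μ := P.map fun x k => I k x with hμ
  have : IsProbabilityMeasure μ := Measure.isProbabilityMeasure_map hmeas.aemeasurable
  have hexp : ∀ g : (Fin n → Fin N) → ℝ, drawExp w n Finset.univ g
      = ∑ i : Fin n → Fin N, if Function.Injective i then μ.real {i} * g i else 0 := by
    intro g
    rw [drawExp_eq_sum]
    refine Finset.sum_congr rfl fun i _ => ?_
    simp only [Finset.mem_univ, implies_true, and_true]
    split_ifs with hi
    · have hset : (fun x k => I k x) ⁻¹' {i} = {x | ∀ k, I k x = i k} := by
        ext x
        simp [funext_iff]
      rw [hμ, map_measureReal_apply hmeas (MeasurableSet.singleton i), hset, hI.law i hi, hw1]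
      rfl
    · rfl
  have htot : ∑ i : Fin n → Fin N, μ.real {i} = 1 := by simp
  -- The prescribed probabilities add up to `1`, so a tuple with repetitions has probability `0`.
  have hnull : ∀ i : Fin n → Fin N, ¬ Function.Injective i → μ.real {i} = 0 := by
    have h1 := hexp fun _ => 1
    rw [drawExp_const hw _ (by simpa using hn), ← htot, ← sub_eq_zero,
      ← Finset.sum_sub_distrib] at h1
    rw [Finset.sum_eq_zero_iff_of_nonneg] at h1
    · intro i hi
      simpa [hi] using h1 i (Finset.mem_univ i)
    · intro i _
      split_ifs <;> simp
  rw [hexp, ← integral_map (f := f) hmeas.aemeasurable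
    (measurable_of_finite f).aestronglyMeasurable, integral_fintype .of_finite]
  refine Finset.sum_congr rfl fun i _ => ?_
  split_ifs with hi
  · rfl
  · rw [hnull i hi, zero_smul]

/-! ### Concentration -/

lemma IsWeightedSample.hasSubgaussianMGF {N n : ℕ} (hn : n ≤ N) {w ν : Fin N → ℝ}
    (hw : ∀ i, 0 < w i) (hw1 : ∑ i, w i = 1) {α Δ : ℝ} (hα0 : 0 < α) (hα1 : α ≤ 1)
    (hα : ∀ i j, α * w i ≤ w j) (hΔ : ∀ i j, |ν i - ν j| ≤ Δ)
    {Ω : Type*} [MeasurableSpace Ω] {P : Measure Ω} [IsProbabilityMeasure P]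
    {I : Fin n → Ω → Fin N} (hI : IsWeightedSample P w I) :
    ProbabilityTheory.HasSubgaussianMGF
      (fun x => cumulativeValue ν I x - ∫ y, cumulativeValue ν I y ∂P)
      ⟨varianceProxy Δ α (N - n) n, varianceProxy_nonneg Δ α (N - n) n⟩ P := by
  have hmeas : Measurable fun x k => I k x := measurable_pi_lambda _ hI.measurable
  have hmean : ∫ y, cumulativeValue ν I y ∂P = drawMean w ν n Finset.univ :=
    hI.integral_eq hn hw hw1 fun i => ∑ k, ν (i k)
  rw [hmean]
  refine ⟨fun s => ?_, fun s => ?_⟩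
  · exact Integrable.comp_measurable (f := fun x k => I k x)
      (g := fun i : Fin n → Fin N => Real.exp (s * (∑ k, ν (i k) - drawMean w ν n Finset.univ)))
      (by
        have := Measure.isProbabilityMeasure_map (μ := P) hmeas.aemeasurable
        exact .of_finite) hmeas
  · have h1 : ProbabilityTheory.mgf
          (fun x => cumulativeValue ν I x - drawMean w ν n Finset.univ) P s
        = Real.exp (-(s * drawMean w ν n Finset.univ)) *
          drawExp w n Finset.univ (fun i => Real.exp (s * ∑ k, ν (i k))) := by
      rw [← drawExp_const_mul, ← hI.integral_eq hn hw hw1]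
      refine integral_congr_ae (.of_forall fun x => ?_)
      simp only [cumulativeValue, ← Real.exp_add]
      congr 1
      ring
    rw [h1]
    refine (mul_le_mul_of_nonneg_left (drawExp_exp_le hw hα0 hα1 hα hΔ s (N - n) n Finset.univ
      (by rw [Finset.card_univ, Fintype.card_fin]; omega)) (Real.exp_pos _).le).trans_eq ?_
    rw [← Real.exp_add]
    congr 1
    change _ = varianceProxy Δ α (N - n) n * s ^ 2 / 2
    ring

theorem theorem2 {N n : ℕ} (hn : n ≤ N) (w ν : Fin N → ℝ)
    (hw : ∀ i, 0 < w i) (hw1 : ∑ i, w i = 1) (hα : weightRatio w < 1)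
    {Ω : Type*} [MeasurableSpace Ω] (P : Measure Ω) [IsProbabilityMeasure P]
    (I : Fin n → Ω → Fin N) (hI : IsWeightedSample P w I) (t : ℝ) (ht : 0 < t) :
    (0 < varianceFactor n w ν →
      max (P.real {x | t < cumulativeValue ν I x - ∫ y, cumulativeValue ν I y ∂P})
          (P.real {x | cumulativeValue ν I x - ∫ y, cumulativeValue ν I y ∂P < -t})
        ≤ Real.exp (-(t ^ 2 / (2 * varianceFactor n w ν)))) ∧
    (varianceFactor n w ν = 0 →
      max (P.real {x | t < cumulativeValue ν I x - ∫ y, cumulativeValue ν I y ∂P})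
          (P.real {x | cumulativeValue ν I x - ∫ y, cumulativeValue ν I y ∂P < -t}) = 0) := by
  have : Nonempty (Fin N) := by
    by_contra h
    rw [not_nonempty_iff] at h
    simp at hw1
  have hbelow : ∀ i, ⨅ i, w i ≤ w i := ciInf_le (Set.finite_range w).bddBelow
  have habove : ∀ i, w i ≤ ⨆ i, w i := le_ciSup (Set.finite_range w).bddAbove
  obtain ⟨i₀, hi₀⟩ := exists_eq_ciInf_of_finite (f := w)
  have hinf : 0 < ⨅ i, w i := hi₀ ▸ hw i₀
  have hsup : 0 < ⨆ i, w i := (hw i₀).trans_le (habove i₀)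
  have hα0 : 0 < weightRatio w := div_pos hinf hsup
  have hratio : ∀ i j, weightRatio w * w i ≤ w j := fun i j =>
    calc weightRatio w * w i ≤ weightRatio w * ⨆ i, w i := by gcongr; exact habove i
      _ = ⨅ i, w i := div_mul_cancel₀ _ hsup.ne'
      _ ≤ w j := hbelow j
  have hΔ : ∀ i j, |ν i - ν j| ≤ valueRange ν := fun i j => by
    have h1 : ∀ i, ⨅ i, ν i ≤ ν i := ciInf_le (Set.finite_range ν).bddBelow
    have h2 : ∀ i, ν i ≤ ⨆ i, ν i := le_ciSup (Set.finite_range ν).bddAbove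
    rw [abs_le, valueRange]
    constructor <;> linarith [h1 i, h1 j, h2 i, h2 j]
  have hle : varianceProxy (valueRange ν) (weightRatio w) (N - n) n ≤ varianceFactor n w ν := by
    refine le_min (varianceProxy_le_left hα0.le _ _) ?_
    have h := varianceProxy_le_right (Δ := valueRange ν) hα0 hα (N - n) n
    rwa [Nat.add_sub_cancel' hn, Nat.cast_sub hn] at h
  have hsub := hI.hasSubgaussianMGF hn hw hw1 hα0 hα.le hratio hΔ
  refine ⟨fun hv => ?_, fun hv => ?_⟩
  · have hsub' : ProbabilityTheory.HasSubgaussianMGF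
        (fun x => cumulativeValue ν I x - ∫ y, cumulativeValue ν I y ∂P)
        ⟨varianceFactor n w ν, hv.le⟩ P := by
      refine ⟨hsub.integrable_exp_mul, fun s => (hsub.mgf_le s).trans (Real.exp_le_exp.2 ?_)⟩
      exact div_le_div_of_nonneg_right (mul_le_mul_of_nonneg_right hle (sq_nonneg s)) zero_le_two
    rw [← neg_div]
    refine max_le (le_trans (measureReal_mono fun x hx => ?_) (hsub'.measure_ge_le ht.le))
      (le_trans (measureReal_mono fun x hx => ?_) (hsub'.neg.measure_ge_le ht.le))
    · rw [Set.mem_ofPred_eq] at hx ⊢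
      exact hx.le
    · rw [Set.mem_ofPred_eq] at hx ⊢
      exact (lt_neg_of_lt_neg hx).le
  · have hzero : (⟨varianceProxy (valueRange ν) (weightRatio w) (N - n) n,
        varianceProxy_nonneg _ _ _ _⟩ : NNReal) = 0 :=
      NNReal.eq (le_antisymm (hle.trans_eq hv) (varianceProxy_nonneg _ _ _ _))
    rw [hzero] at hsub
    have hae := hsub.ae_eq_zero_of_hasSubgaussianMGF_zero
    have h1 : P {x | t < cumulativeValue ν I x - ∫ y, cumulativeValue ν I y ∂P} = 0 := by
      rw [measure_eq_zero_iff_ae_notMem]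
      filter_upwards [hae] with x hx
      rw [hx, not_lt]
      exact ht.le
    have h2 : P {x | cumulativeValue ν I x - ∫ y, cumulativeValue ν I y ∂P < -t} = 0 := by
      rw [measure_eq_zero_iff_ae_notMem]
      filter_upwards [hae] with x hx
      rw [hx, not_lt]
      exact neg_nonpos.2 ht.le
    simp [Measure.real, h1, h2]
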